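/- Let $\mathcal H$ be a separable infinite-dimensional complex Hilbert space, $\mathcal B(\mathcal H)$ the algebra of bounded operators with operator norm $\Vert\cdot\Vert$, and $\mathcal F(\mathcal H)$ the ideal of finite-rank operators. A symmetrically normed ideal is a two-sided ideal $\mathcal I\subseteq\mathcal B(\mathcal H)$ endowed with a norm $\Vert\cdot\Vert_{\mathcal I}$ under which it is a Banach space, with $\Vert axb\Vert_{\mathcal I}\le\Vert a\Vert\,\Vert x\Vert_{\mathcal I}\,\Vert b\Vert$ for all $x\in\mathcal I$, $a,b\in\mathcal B(\mathcal H)$, and with $\Vert p\Vert_{\mathcal I}=1$ for every rank-one orthogonal projection $p\in\mathcal I$. For a two-sided ideal $\mathcal J\subseteq\mathcal B(\mathcal H)$ and $a\in\mathcal B(\mathcal H)$ let $$\mathcal O_{\mathcal J}(a)=\{uau^*\mid u\in\mathcal B(\mathcal H)\text{ unitary},\ u-\mathbf 1\in\mathcal J\}.$$ Closures with respect to $\Vert\cdot\Vert_{\mathcal I}$ (of subsets of $\mathcal I$) are taken in $\mathcal I$, and closures with respect to $\Vert\cdot\Vert$ are taken in $\mathcal B(\mathcal H)$. **Theorem.**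 For any symmetrically normed ideal $\mathcal I\subsetneqq\mathcal B(\mathcal H)$, the following conditions are equivalent: (i) The ideal $\mathcal I$ is separable with respect to $\Vert\cdot\Vert_{\mathcal I}$. (ii) For every normal $a\in\mathcal I$ one has $\overline{\mathcal O_{\mathcal B(\mathcal H)}(a)}^{\Vert\cdot\Vert}\subseteq\overline{\mathcal O_{\mathcal F(\mathcal H)}(a)}^{\Vert\cdot\Vert_{\mathcal I}}$. (iii) For every $a\in\mathcal I$ with $a\ge 0$ one has $\mathcal O_{\mathcal B(\mathcal H)}(a)\subseteq\overline{\mathcal O_{\mathcal F(\mathcal H)}(a)}^{\Vert\cdot\Vert_{\mathcal I}}$. If any of these conditions is satisfied, then for every normal $a\in\mathcal I$ one has $$\overline{\mathcal O_{\mathcal F(\mathcal H)}(a)}^{\Vert\cdot\Vert_{\mathcal I}}=\overline{\mathcal O_{\mathcal I}(a)}^{\Vert\cdot\Vert_{\mathcal I}}=\overline{\mathcal O_{\mathcal B(\mathcal H)}(a)}^{\Vert\cdot\Vert_{\mathcal I}}=\overline{\mathcal O_{\mathcal B(\mathcal H)}(a)}^{\Vert\cdot\Vert}.$$ -/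

import Mathlib

/-- The two-sided ideal of finite-rank operators on `H`. -/
def finiteRankIdeal (H : Type*) [NormedAddCommGroup H] [InnerProductSpace ℂ H] :
    Ideal (H →L[ℂ] H) where
  carrier := {x | FiniteDimensional ℂ (LinearMap.range (x : H →ₗ[ℂ] H))}
  zero_mem' := by
    have h : LinearMap.range ((0 : H →L[ℂ] H) : H →ₗ[ℂ] H) = ⊥ := by
      ext y
      simp
    rw [Set.mem_ofPred_eq, h]
    infer_instance
  add_mem' := by
    intro x y hx hy
    rw [Set.mem_ofPred_eq] at hx hy ⊢
    have := hx
    have := hy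
    refine Submodule.finiteDimensional_of_le
      (S₂ := LinearMap.range (x : H →ₗ[ℂ] H) ⊔ LinearMap.range (y : H →ₗ[ℂ] H)) ?_
    rintro _ ⟨v, rfl⟩
    exact Submodule.add_mem_sup ⟨v, rfl⟩ ⟨v, rfl⟩
  smul_mem' := by
    intro c x hx
    rw [Set.mem_ofPred_eq] at hx ⊢
    have := hx
    refine Submodule.finiteDimensional_of_le
      (S₂ := (LinearMap.range (x : H →ₗ[ℂ] H)).map (c : H →ₗ[ℂ] H)) ?_
    rintro _ ⟨v, rfl⟩
    exact ⟨x v, ⟨v, rfl⟩, rfl⟩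

/-- A two-sided ideal of `B(H)` together with a norm on it (in general not the operator norm). -/
structure NormedOperatorIdeal (H : Type*) [NormedAddCommGroup H] [InnerProductSpace ℂ H] where
  ideal : Ideal (H →L[ℂ] H)
  isTwoSided : ideal.IsTwoSided
  idealNorm : Seminorm ℂ ideal
  eq_zero_of_idealNorm_eq_zero : ∀ x : ideal, idealNorm x = 0 → x = 0

namespace NormedOperatorIdeal

variable {H : Type*} [NormedAddCommGroup H] [InnerProductSpace ℂ H]

/-- The ideal as a normed space under its own norm. This is a separate type so that the operator
norm that the ideal inherits from `B(H)` is not used on it. -/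
def Space (I : NormedOperatorIdeal H) : Type _ := I.ideal

noncomputable instance (I : NormedOperatorIdeal H) : AddCommGroup I.Space :=
  inferInstanceAs (AddCommGroup I.ideal)

noncomputable instance (I : NormedOperatorIdeal H) : Module ℂ I.Space :=
  inferInstanceAs (Module ℂ I.ideal)

noncomputable instance (I : NormedOperatorIdeal H) : Norm I.Space := ⟨fun x => I.idealNorm x⟩

theorem space_core (I : NormedOperatorIdeal H) : NormedSpace.Core ℂ I.Space where
  norm_nonneg x := apply_nonneg I.idealNorm x
  norm_smul c x := map_smul_eq_mul I.idealNorm c x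
  norm_triangle x y := map_add_le_add I.idealNorm x y
  norm_eq_zero_iff x := ⟨I.eq_zero_of_idealNorm_eq_zero x, fun h => by
    subst h
    exact map_zero I.idealNorm⟩

noncomputable instance (I : NormedOperatorIdeal H) : NormedAddCommGroup I.Space :=
  NormedAddCommGroup.ofCore I.space_core

noncomputable instance (I : NormedOperatorIdeal H) : NormedSpace ℂ I.Space :=
  NormedSpace.ofCore I.space_core

/-- The inclusion of the ideal into `B(H)`. -/
def toOp (I : NormedOperatorIdeal H) (x : I.Space) : H →L[ℂ] H := Subtype.val x

/-- The closure of `S` (a set of operators in the ideal) with respect to the norm of the ideal,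
as a set of operators. -/
def normClosure (I : NormedOperatorIdeal H) (S : Set (H →L[ℂ] H)) : Set (H →L[ℂ] H) :=
  I.toOp '' closure (I.toOp ⁻¹' S)

end NormedOperatorIdeal

/-- A symmetrically normed ideal: a two-sided ideal of `B(H)`, complete under a norm with
`‖a x b‖_I ≤ ‖a‖ ‖x‖_I ‖b‖`, which is normalized to be `1 = ‖p‖` on the rank-one orthogonal
projections `p = ξ ⊗ ξ̄` in the ideal. -/
structure SymmetricallyNormedIdeal (H : Type*) [NormedAddCommGroup H] [InnerProductSpace ℂ H]
    extends NormedOperatorIdeal H where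
  norm_le : ∀ (a b : H →L[ℂ] H) (x y : toNormedOperatorIdeal.Space),
    toNormedOperatorIdeal.toOp y = a * toNormedOperatorIdeal.toOp x * b →
      ‖y‖ ≤ ‖a‖ * ‖x‖ * ‖b‖
  norm_rankOne : ∀ (ξ : H), ‖ξ‖ = 1 → ∀ x : toNormedOperatorIdeal.Space,
    toNormedOperatorIdeal.toOp x = InnerProductSpace.rankOne ℂ ξ ξ → ‖x‖ = 1
  complete : CompleteSpace toNormedOperatorIdeal.Space

section Orbits

variable {H : Type*} [NormedAddCommGroup H] [InnerProductSpace ℂ H] [CompleteSpace H]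

/-- The congruence unitary group `U_J = (1 + J) ∩ U(H)` of an ideal `J` of `B(H)`, as a set. -/
def unitaryCongruence (J : Ideal (H →L[ℂ] H)) : Set (H →L[ℂ] H) :=
  {u | u ∈ unitary (H →L[ℂ] H) ∧ u - 1 ∈ J}

/-- The unitary orbit `O_J(a) = {u a u* | u ∈ U_J}`; for `J = ⊤` it is the full unitary orbit. -/
def unitaryOrbit (J : Ideal (H →L[ℂ] H)) (a : H →L[ℂ] H) : Set (H →L[ℂ] H) :=
  {b | ∃ u ∈ unitaryCongruence J, b = u * a * star u}

end Orbits

/-! Separability enters through a pigeonhole argument. There are uncountably many isometries `v t`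
with `star (v t) * v t'` of finite rank for `t ≠ t'`. If the ideal is separable, two of the
operators `v t * x` are close in its norm, so `x` is close to a finite-rank multiple of itself.
Hence every `x` in the ideal is almost supported, on both sides, on a finite-dimensional subspace
(`exists_starProjection_approx`). A unitary can be replaced there by one in `1 + F`
(`unitaryOrbit_top_subset`). Moreover, on a full orbit, closeness in operator norm forces closeness
in the ideal norm (`exists_normLE_of_norm_sub_le`), so by completeness the two closures of that
orbit agree.

Conversely, let `F̄` be the closure of the finite-rank operators in the ideal norm. The orbit
condition for `a` puts all commutators `x * a - a * x` in `F̄`, because unitaries span `B(H)`.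
Properness of the ideal gives orthonormal vectors on which `a` decays geometrically, hence an
isometry `v` with `a * v ∈ F̄`. Then `v * a ∈ F̄`, and so `a = star v * (v * a) ∈ F̄`. Positive
operators suffice by polar decomposition, and `F̄` is separable because rank-one operators depend
continuously on their two vectors. -/

open scoped InnerProductSpace

/-! ### Finite-rank operators, isometries and unitaries on Hilbert space -/

section Operators

variable {H : Type*} [NormedAddCommGroup H] [InnerProductSpace ℂ H]

theorem mem_finiteRankIdeal_of_range_le {x : H →L[ℂ] H} (E : Submodule ℂ H)
    [FiniteDimensional ℂ E] (h : ∀ y, x y ∈ E) : x ∈ finiteRankIdeal H := by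
  refine Submodule.finiteDimensional_of_le (S₂ := E) ?_
  rintro _ ⟨y, rfl⟩
  exact h y

theorem finiteRankIdeal_mul_right {x : H →L[ℂ] H} (hx : x ∈ finiteRankIdeal H) (c : H →L[ℂ] H) :
    x * c ∈ finiteRankIdeal H := by
  have : FiniteDimensional ℂ (LinearMap.range (x : H →ₗ[ℂ] H)) := hx
  exact mem_finiteRankIdeal_of_range_le (LinearMap.range (x : H →ₗ[ℂ] H)) fun y => ⟨c y, rfl⟩

theorem starProjection_mem_finiteRankIdeal (E : Submodule ℂ H) [FiniteDimensional ℂ E] :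
    E.starProjection ∈ finiteRankIdeal H :=
  mem_finiteRankIdeal_of_range_le E fun y => E.starProjection_apply_mem y

theorem add_starProjection_orthogonal_apply_apply (G : Submodule ℂ H) [FiniteDimensional ℂ G] (L M : G →ₗᵢ[ℂ] G)
    (x : H)
    (hLM : ∀ y, L (M y) = y) :
    (G.subtypeL ∘L L.toContinuousLinearMap ∘L G.orthogonalProjectionOnto + Gᗮ.starProjection)
      ((G.subtypeL ∘L M.toContinuousLinearMap ∘L G.orthogonalProjectionOnto + Gᗮ.starProjection) x)
      = x := by
  have h1 : G.orthogonalProjectionOnto (Gᗮ.starProjection x) = 0 :=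
    Submodule.orthogonalProjectionOnto_eq_zero_iff.2 (Gᗮ.starProjection_apply_mem x)
  have h2 : Gᗮ.starProjection ((M (G.orthogonalProjectionOnto x) : G) : H) = 0 := by
    rw [Submodule.starProjection_orthogonal']
    simp
  have h3 : Gᗮ.starProjection (Gᗮ.starProjection x) = Gᗮ.starProjection x :=
    Submodule.starProjection_eq_self_iff.2 (Gᗮ.starProjection_apply_mem x)
  simp only [add_apply, ContinuousLinearMap.comp_apply, map_add,
    Submodule.subtypeL_apply, LinearIsometry.coe_toContinuousLinearMap,
    Submodule.orthogonalProjectionOnto_mem_subspace_eq_self, hLM, h1, h2, h3]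
  rw [Submodule.starProjection_orthogonal']
  simp

variable [CompleteSpace H]

/-- A form of Douglas' factorization lemma. -/
theorem exists_eq_mul_of_norm_le {A B : H →L[ℂ] H} (c : ℝ) (h : ∀ x, ‖A x‖ ≤ c * ‖B x‖) :
    ∃ C : H →L[ℂ] H, A = C * B := by
  let K := (LinearMap.range (B : H →ₗ[ℂ] H)).topologicalClosure
  have hBK : ∀ x, B x ∈ K := fun x => Submodule.le_topologicalClosure _ ⟨x, rfl⟩
  let e : H →ₗ[ℂ] K := (B : H →ₗ[ℂ] H).codRestrict K hBK
  have hd : DenseRange e := by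
    intro y
    have hy : (y : H) ∈ closure (Set.range B) := y.2
    rw [Metric.mem_closure_iff] at hy ⊢
    intro ε hε
    obtain ⟨_, ⟨x, rfl⟩, hx⟩ := hy ε hε
    exact ⟨e x, ⟨x, rfl⟩, hx⟩
  have : CompleteSpace K := (Submodule.isClosed_topologicalClosure _).completeSpace_coe
  -- The map `B x ↦ A x` is bounded on the range of `B`; it is extended to the closure `K` and by
  -- zero on the orthogonal complement.
  refine ⟨((A : H →ₗ[ℂ] H).extendOfNorm e) ∘L K.orthogonalProjectionOnto, ?_⟩
  ext x
  have h1 : K.orthogonalProjectionOnto (B x) = e x :=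
    K.orthogonalProjectionOnto_mem_subspace_eq_self (e x)
  have h2 := LinearMap.extendOfNorm_eq (f := (A : H →ₗ[ℂ] H)) hd ⟨c, h⟩ x
  simp [h1, h2]

theorem exists_hilbertBasis_nat [TopologicalSpace.SeparableSpace H]
    (hH : ¬ FiniteDimensional ℂ H) : Nonempty (HilbertBasis ℕ ℂ H) := by
  obtain ⟨w, b, hb⟩ := exists_hilbertBasis ℂ H
  have hc : Countable w := by
    refine Pairwise.countable_of_isOpen_disjoint (s := fun i : w => Metric.ball (b i) (1 / 2)) ?_
      (fun i => Metric.isOpen_ball) fun i => ⟨b i, by simp⟩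
    intro i j hij
    refine Metric.ball_disjoint_ball ?_
    have h1 : ‖b i - b j‖ * ‖b i - b j‖ = 2 := by
      rw [@norm_sub_mul_self ℂ, b.orthonormal.2 hij, b.orthonormal.1, b.orthonormal.1]
      norm_num
    rw [dist_eq_norm]
    nlinarith [norm_nonneg (b i - b j)]
  have hi : Infinite w := by
    by_contra hf
    rw [not_infinite_iff_finite] at hf
    have := Fintype.ofFinite w
    exact hH (b.toOrthonormalBasis.toBasis.finiteDimensional_of_finite)
  obtain ⟨e⟩ := nonempty_equiv_of_countable (α := ℕ) (β := w)
  refine ⟨HilbertBasis.mk (b.orthonormal.comp e e.injective) ?_⟩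
  rw [e.surjective.range_comp, b.dense_span]

theorem exists_isometry_map_basis (b : HilbertBasis ℕ ℂ H) {f : ℕ → H} (hf : Orthonormal ℂ f) :
    ∃ v : H →L[ℂ] H, star v * v = 1 ∧ ∀ k, v (b k) = f k := by
  let V : H →ₗᵢ[ℂ] H := hf.orthogonalFamily.linearIsometry.comp b.repr.toLinearIsometry
  refine ⟨V.toContinuousLinearMap, ?_, fun k => ?_⟩
  · exact (ContinuousLinearMap.norm_map_iff_adjoint_comp_self _).1 V.norm_map
  · simp [V, b.repr_self]

/-- The restriction to the first `k` values of a sequence of booleans, encoded as a number. -/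
def prefixCode (t : ℕ → Bool) (k : ℕ) : ℕ := Encodable.encode ((List.range k).map t)

theorem prefixCode_eq {t t' : ℕ → Bool} {k k' : ℕ} (h : prefixCode t k = prefixCode t' k') :
    k = k' ∧ ∀ i < k, t i = t' i := by
  have h1 := Encodable.encode_injective h
  have h2 : k = k' := by simpa using congrArg List.length h1
  subst h2
  exact ⟨rfl, by simpa [List.map_inj_left] using h1⟩

/-- The product kills `b k` for `k ≥ K`, so it maps the span of the basis into a finite-dimensional,
hence closed, subspace; density does the rest. -/
theorem star_mul_mem_finiteRankIdeal_of_inner_eq_zero (b : HilbertBasis ℕ ℂ H) {v w : H →L[ℂ] H}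
    (K : ℕ) (h : ∀ k ≥ K, ∀ j, ⟪v (b j), w (b k)⟫_ℂ = 0) :
    star v * w ∈ finiteRankIdeal H := by
  let E := Submodule.span ℂ ((fun k => star v (w (b k))) '' Set.Iio K)
  have : FiniteDimensional ℂ E := FiniteDimensional.span_of_finite ℂ ((Set.finite_Iio K).image _)
  refine mem_finiteRankIdeal_of_range_le E ?_
  have hb : ∀ k, (star v * w) (b k) ∈ E := by
    intro k
    rcases lt_or_ge k K with hk | hk
    · exact Submodule.subset_span ⟨k, hk, rfl⟩
    · have : (star v * w) (b k) = 0 := by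
        rw [← b.repr.map_eq_zero_iff]
        ext j
        rw [b.repr_apply_apply]
        simpa [ContinuousLinearMap.star_eq_adjoint, ContinuousLinearMap.adjoint_inner_right]
          using h k hk j
      rw [this]
      exact E.zero_mem
  have hcl : IsClosed ((E.comap ((star v * w : H →L[ℂ] H) : H →ₗ[ℂ] H) : Submodule ℂ H) : Set H) :=
    E.closed_of_finiteDimensional.preimage (star v * w).continuous
  have hle : (⊤ : Submodule ℂ H) ≤ E.comap ((star v * w : H →L[ℂ] H) : H →ₗ[ℂ] H) := by
    rw [← b.dense_span]
    refine Submodule.topologicalClosure_minimal _ (Submodule.span_le.2 ?_) hcl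
    rintro _ ⟨k, rfl⟩
    exact hb k
  exact fun y => hle trivial

/-- There is a family of isometries, indexed by the Cantor set, whose ranges are pairwise orthogonal
up to finite dimensions. -/
theorem exists_almost_orthogonal_isometries (b : HilbertBasis ℕ ℂ H) :
    ∃ v : (ℕ → Bool) → H →L[ℂ] H, (∀ t, star (v t) * v t = 1) ∧
      ∀ t t', t ≠ t' → star (v t) * v t' ∈ finiteRankIdeal H := by
  have hinj : ∀ t, Function.Injective (prefixCode t) := fun t k k' h => (prefixCode_eq h).1
  -- `v t` sends `b k` to the basis vector indexed by the code of the first `k` values of `t`.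
  -- Distinct sequences share only finitely many prefixes.
  choose v hv hvb using fun t : ℕ → Bool =>
    exists_isometry_map_basis b (b.orthonormal.comp (prefixCode t) (hinj t))
  refine ⟨v, hv, fun t t' htt => ?_⟩
  obtain ⟨i, hi⟩ := Function.ne_iff.1 htt
  -- Prefixes of length at least `i + 1` include the position `i` where `t` and `t'` differ.
  refine star_mul_mem_finiteRankIdeal_of_inner_eq_zero b (i + 1) fun k hk j => ?_
  rw [hvb, hvb]
  refine b.orthonormal.2 fun h => ?_
  obtain ⟨rfl, h2⟩ := prefixCode_eq h
  exact hi (h2 i hk)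

theorem norm_le_one_of_star_mul_self {v : H →L[ℂ] H} (h : star v * v = 1) : ‖v‖ ≤ 1 := by
  refine v.opNorm_le_bound zero_le_one fun x => ?_
  rw [one_mul]
  exact ((ContinuousLinearMap.norm_map_iff_adjoint_comp_self v).2 h x).le

/-- On the finite-dimensional space `G = E + uE`, the isometry `u|E` extends to a unitary of `G`;
the identity is taken on `Gᗮ`. -/
theorem exists_unitary_eqOn (E : Submodule ℂ H) [FiniteDimensional ℂ E] {u : H →L[ℂ] H}
    (hu : u ∈ unitary (H →L[ℂ] H)) :
    ∃ w ∈ unitaryCongruence (finiteRankIdeal H), ∀ x ∈ E, w x = u x := by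
  have hun : ∀ x, ‖u x‖ = ‖x‖ :=
    (ContinuousLinearMap.norm_map_iff_adjoint_comp_self u).2 (Unitary.star_mul_self_of_mem hu)
  let G := E ⊔ E.map (u : H →ₗ[ℂ] H)
  let L₀ : (E.comap G.subtype) →ₗᵢ[ℂ] G :=
    { toLinearMap := LinearMap.codRestrict G ((u : H →ₗ[ℂ] H) ∘ₗ G.subtype ∘ₗ Submodule.subtype _)
        fun x => Submodule.mem_sup_right ⟨x.1.1, x.2, rfl⟩
      norm_map' := fun x => hun x.1.1 }
  let L := L₀.extend
  let Le := L.toLinearIsometryEquiv rfl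
  have hLe : ∀ y, L (Le.symm y) = y := Le.apply_symm_apply
  let T : (G →ₗᵢ[ℂ] G) → (H →L[ℂ] H) := fun L =>
    G.subtypeL ∘L L.toContinuousLinearMap ∘L G.orthogonalProjectionOnto + Gᗮ.starProjection
  have hTn : star (T L) * T L = 1 := by
    refine (ContinuousLinearMap.norm_map_iff_adjoint_comp_self _).1 fun x => ?_
    have h0 : T L x = (L (G.orthogonalProjectionOnto x) : H) + Gᗮ.starProjection x := rfl
    rw [h0, ← sq_eq_sq₀ (norm_nonneg _) (norm_nonneg _),
      Submodule.norm_sq_eq_add_norm_sq_projection x G,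
      sq, norm_add_sq_eq_norm_sq_add_norm_sq_of_inner_eq_zero _ _
        (Submodule.inner_right_of_mem_orthogonal (L (G.orthogonalProjectionOnto x)).2
          (Gᗮ.starProjection_apply_mem x))]
    have h4 : ‖((L (G.orthogonalProjectionOnto x) : G) : H)‖ = ‖G.orthogonalProjectionOnto x‖ :=
      L.norm_map _
    rw [h4, sq, sq]
    rfl
  have hTT : T L * T Le.symm.toLinearIsometry = 1 := by
    ext x
    exact add_starProjection_orthogonal_apply_apply G L Le.symm.toLinearIsometry x hLe
  have hstar : star (T L) = T Le.symm.toLinearIsometry := left_inv_eq_right_inv hTn hTT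
  refine ⟨T L, ⟨Unitary.mem_iff.2 ⟨hTn, by rw [hstar, hTT]⟩, ?_⟩, fun x hx => ?_⟩
  · refine mem_finiteRankIdeal_of_range_le G fun y => ?_
    have : (T L - 1) y = (L (G.orthogonalProjectionOnto y) : H) - G.starProjection y := by
      simp only [T, Submodule.starProjection_orthogonal']
      simp
      abel
    rw [this]
    exact G.sub_mem (L (G.orthogonalProjectionOnto y)).2 (G.starProjection_apply_mem y)
  · have hxG : x ∈ G := Submodule.mem_sup_left hx
    have h1 : G.orthogonalProjectionOnto x = ⟨x, hxG⟩ :=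
      G.orthogonalProjectionOnto_mem_subspace_eq_self ⟨x, hxG⟩
    have h2 : Gᗮ.starProjection x = 0 := by
      rw [Submodule.starProjection_orthogonal']
      simp [Submodule.starProjection_eq_self_iff.2 hxG]
    have h3 : T L x = (L (G.orthogonalProjectionOnto x) : H) + Gᗮ.starProjection x := rfl
    have h4 : L ⟨x, hxG⟩ = L₀ ⟨⟨x, hxG⟩, hx⟩ := L₀.extend_apply ⟨⟨x, hxG⟩, hx⟩
    rw [h3, h1, h2, h4, add_zero]
    rfl

theorem mem_span_rankOne_of_mem_finiteRankIdeal {x : H →L[ℂ] H} (hx : x ∈ finiteRankIdeal H) :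
    x ∈ Submodule.span ℂ
      (Set.range fun p : H × H => (InnerProductSpace.rankOne ℂ p.1 p.2 : H →L[ℂ] H)) := by
  have : FiniteDimensional ℂ (LinearMap.range (x : H →ₗ[ℂ] H)) := hx
  have h1 : (LinearMap.range (x : H →ₗ[ℂ] H)).starProjection * x = x := by
    ext y
    exact Submodule.starProjection_eq_self_iff.2 ⟨y, rfl⟩
  rw [← h1, (stdOrthonormalBasis ℂ _).starProjection_eq_sum_rankOne,
    Finset.sum_mul]
  refine Submodule.sum_mem _ fun i _ => Submodule.subset_span ?_
  rw [ContinuousLinearMap.mul_def, InnerProductSpace.rankOne_comp]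
  exact ⟨(_, _), rfl⟩

end Operators

/-! ### Calculus of the ideal norm and rank-one operators -/

namespace SymmetricallyNormedIdeal

section Basic

variable {H : Type*} [NormedAddCommGroup H] [InnerProductSpace ℂ H]
  (I : SymmetricallyNormedIdeal H)

/-- The operator `x` belongs to the ideal, and its norm there is at most `r`. -/
def NormLE (x : H →L[ℂ] H) (r : ℝ) : Prop := ∃ y : I.Space, I.toOp y = x ∧ ‖y‖ ≤ r

variable {I}

theorem normLE_toOp (y : I.Space) : I.NormLE (I.toOp y) ‖y‖ := ⟨y, rfl, le_rfl⟩

theorem toOp_injective : Function.Injective I.toOp := Subtype.val_injective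

theorem toOp_mem (y : I.Space) : I.toOp y ∈ I.ideal := y.2

theorem exists_toOp_eq {x : H →L[ℂ] H} (hx : x ∈ I.ideal) : ∃ y : I.Space, I.toOp y = x :=
  ⟨⟨x, hx⟩, rfl⟩

theorem normLE_toOp_iff {y : I.Space} {r : ℝ} : I.NormLE (I.toOp y) r ↔ ‖y‖ ≤ r :=
  ⟨fun ⟨_, hz, h⟩ => toOp_injective hz ▸ h, fun h => ⟨y, rfl, h⟩⟩

theorem NormLE.mem {x : H →L[ℂ] H} {r : ℝ} (h : I.NormLE x r) : x ∈ I.ideal := by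
  obtain ⟨y, rfl, -⟩ := h
  exact y.2

theorem exists_normLE {x : H →L[ℂ] H} (hx : x ∈ I.ideal) : ∃ r, 0 ≤ r ∧ I.NormLE x r := by
  obtain ⟨y, rfl⟩ := exists_toOp_eq hx
  exact ⟨‖y‖, norm_nonneg y, normLE_toOp y⟩

theorem NormLE.nonneg {x : H →L[ℂ] H} {r : ℝ} (h : I.NormLE x r) : 0 ≤ r := by
  obtain ⟨y, -, h⟩ := h
  exact (norm_nonneg y).trans h

theorem NormLE.mono {x : H →L[ℂ] H} {r s : ℝ} (h : I.NormLE x r) (hrs : r ≤ s) : I.NormLE x s := by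
  obtain ⟨y, hy, h⟩ := h
  exact ⟨y, hy, h.trans hrs⟩

theorem NormLE.add {x y : H →L[ℂ] H} {r s : ℝ} (hx : I.NormLE x r) (hy : I.NormLE y s) :
    I.NormLE (x + y) (r + s) := by
  obtain ⟨x, rfl, hx⟩ := hx
  obtain ⟨y, rfl, hy⟩ := hy
  exact ⟨x + y, rfl, (norm_add_le x y).trans (add_le_add hx hy)⟩

theorem NormLE.sub {x y : H →L[ℂ] H} {r s : ℝ} (hx : I.NormLE x r) (hy : I.NormLE y s) :
    I.NormLE (x - y) (r + s) := by
  obtain ⟨x, rfl, hx⟩ := hx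
  obtain ⟨y, rfl, hy⟩ := hy
  exact ⟨x - y, rfl, (norm_sub_le x y).trans (add_le_add hx hy)⟩

theorem mul_mem (a b : H →L[ℂ] H) {x : H →L[ℂ] H} (hx : x ∈ I.ideal) : a * x * b ∈ I.ideal := by
  have := I.isTwoSided
  exact I.ideal.mul_mem_right b (I.ideal.mul_mem_left a hx)

theorem NormLE.mul_mul {x a b : H →L[ℂ] H} {r α β : ℝ} (hx : I.NormLE x r) (ha : ‖a‖ ≤ α)
    (hb : ‖b‖ ≤ β) : I.NormLE (a * x * b) (α * r * β) := by
  have hr := hx.nonneg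
  obtain ⟨x, rfl, hx⟩ := hx
  obtain ⟨y, hy⟩ := exists_toOp_eq (mul_mem a b (toOp_mem x))
  refine ⟨y, hy, (I.norm_le a b x y hy).trans ?_⟩
  have := (norm_nonneg a).trans ha
  gcongr

theorem norm_one_le : ‖(1 : H →L[ℂ] H)‖ ≤ 1 := ContinuousLinearMap.norm_id_le

theorem NormLE.mul_left {x a : H →L[ℂ] H} {r α : ℝ} (hx : I.NormLE x r) (ha : ‖a‖ ≤ α) :
    I.NormLE (a * x) (α * r) := by
  simpa using hx.mul_mul ha norm_one_le

theorem NormLE.mul_right {x b : H →L[ℂ] H} {r β : ℝ} (hx : I.NormLE x r) (hb : ‖b‖ ≤ β) :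
    I.NormLE (x * b) (r * β) := by
  simpa using hx.mul_mul norm_one_le hb

theorem mem_normClosure {S : Set (H →L[ℂ] H)} {b : H →L[ℂ] H} :
    b ∈ I.normClosure S ↔ b ∈ I.ideal ∧ ∀ ε > 0, ∃ z ∈ S, z ∈ I.ideal ∧ I.NormLE (b - z) ε := by
  constructor
  · rintro ⟨y, hy, rfl⟩
    refine ⟨toOp_mem y, fun ε hε => ?_⟩
    obtain ⟨z, hz, hyz⟩ := Metric.mem_closure_iff.1 hy ε hε
    exact ⟨I.toOp z, hz, toOp_mem z, y - z, rfl, by rw [← dist_eq_norm]; exact hyz.le⟩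
  · rintro ⟨hb, h⟩
    obtain ⟨y, rfl⟩ := exists_toOp_eq hb
    refine ⟨y, Metric.mem_closure_iff.2 fun ε hε => ?_, rfl⟩
    obtain ⟨z, hz, hzI, hyz⟩ := h (ε / 2) (half_pos hε)
    obtain ⟨z, rfl⟩ := exists_toOp_eq hzI
    refine ⟨z, hz, ?_⟩
    have : ‖y - z‖ ≤ ε / 2 := normLE_toOp_iff.1 hyz
    rw [dist_eq_norm]
    linarith

theorem normClosure_mono {S T : Set (H →L[ℂ] H)} (h : S ⊆ T) :
    I.normClosure S ⊆ I.normClosure T :=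
  Set.image_mono (closure_mono (Set.preimage_mono h))

theorem normClosure_subset_normClosure {S T : Set (H →L[ℂ] H)} (h : S ⊆ I.normClosure T) :
    I.normClosure S ⊆ I.normClosure T := by
  refine Set.image_mono (closure_minimal (fun x hx => ?_) isClosed_closure)
  obtain ⟨y, hy, hxy⟩ := h hx
  exact toOp_injective hxy ▸ hy

end Basic

section RankOne

variable {H : Type*} [NormedAddCommGroup H] [InnerProductSpace ℂ H]
  {I : SymmetricallyNormedIdeal H}

/-- A nonzero member of the ideal, compressed between suitable rank-one operators, yields any
rank-one operator. -/
theorem rankOne_mem (hI : I.ideal ≠ ⊥) (η ζ : H) : InnerProductSpace.rankOne ℂ η ζ ∈ I.ideal := by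
  obtain ⟨x, hx, hx0⟩ := Submodule.exists_mem_ne_zero_of_ne_bot hI
  obtain ⟨ξ, hξ⟩ : ∃ ξ, x ξ ≠ 0 := by
    by_contra! h
    exact hx0 (ContinuousLinearMap.ext h)
  have h1 : ⟪x ξ, x ξ⟫_ℂ ≠ 0 := inner_self_ne_zero.2 hξ
  have : InnerProductSpace.rankOne ℂ η ζ =
      InnerProductSpace.rankOne ℂ η ((⟪x ξ, x ξ⟫_ℂ)⁻¹ • x ξ) * x *
      InnerProductSpace.rankOne ℂ ξ ζ := by
    ext y
    have h2 : (starRingEnd ℂ) ⟪x ξ, x ξ⟫_ℂ = ⟪x ξ, x ξ⟫_ℂ := inner_conj_symm _ _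
    simp only [mul_apply_eq_comp, InnerProductSpace.rankOne_apply, map_smul,
      inner_smul_left, map_inv₀, h2]
    rw [inv_mul_cancel₀ h1, one_smul]
  rw [this]
  exact mul_mem _ _ hx

theorem normLE_rankOne (hI : I.ideal ≠ ⊥) (η ζ : H) :
    I.NormLE (InnerProductSpace.rankOne ℂ η ζ) (‖η‖ * ‖ζ‖) := by
  obtain ⟨y, hy⟩ := exists_toOp_eq (rankOne_mem hI η ζ)
  by_cases hη : η = 0
  · have : y = 0 := toOp_injective (by rw [hy, hη, map_zero]; rfl)
    exact ⟨y, hy, by simp [this, hη]⟩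
  · set ξ : H := ((‖η‖⁻¹ : ℝ) : ℂ) • η with hξ
    have hξ1 : ‖ξ‖ = 1 := by
      rw [hξ, norm_smul, Complex.norm_real, norm_inv, norm_norm,
        inv_mul_cancel₀ (norm_ne_zero_iff.2 hη)]
    obtain ⟨p, hp⟩ := exists_toOp_eq (rankOne_mem hI ξ ξ)
    have hp1 : ‖p‖ = 1 := I.norm_rankOne ξ hξ1 p hp
    have h := I.norm_le (InnerProductSpace.rankOne ℂ η ξ) (InnerProductSpace.rankOne ℂ ξ ζ) p y (by
      rw [hy, hp]
      ext z
      simp [hξ1])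
    rw [hp1] at h
    simp only [InnerProductSpace.norm_rankOne, hξ1] at h
    exact ⟨y, hy, by simpa using h⟩

/-- For a unit vector `ξ`, sandwiching `x` between `ξ ⊗ xξ` and `ξ ⊗ ξ` gives `‖xξ‖²` times a
rank-one projection, so `‖xξ‖² ≤ ‖xξ‖ ‖x‖_I`. -/
theorem norm_toOp_le (x : I.Space) : ‖I.toOp x‖ ≤ ‖x‖ := by
  refine (I.toOp x).opNorm_le_of_unit_norm (norm_nonneg x) fun ξ hξ => ?_
  by_cases hI : I.ideal = ⊥
  · have : I.toOp x = 0 := by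
      have h := toOp_mem x
      rwa [hI, Submodule.mem_bot] at h
    simp [this]
  obtain ⟨p, hp⟩ := exists_toOp_eq (rankOne_mem hI ξ ξ)
  have hp1 : ‖p‖ = 1 := I.norm_rankOne ξ hξ p hp
  have h := I.norm_le (InnerProductSpace.rankOne ℂ ξ (I.toOp x ξ)) (InnerProductSpace.rankOne ℂ ξ ξ)
    x (((‖I.toOp x ξ‖ ^ 2 : ℝ) : ℂ) • p) (by
      change ((‖I.toOp x ξ‖ ^ 2 : ℝ) : ℂ) • I.toOp p = _
      rw [hp]
      ext z
      simp [smul_smul, mul_comm])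
  rw [norm_smul, hp1] at h
  simp only [InnerProductSpace.norm_rankOne, hξ, Complex.norm_real, norm_pow, norm_norm, mul_one,
    one_mul] at h
  rw [sq] at h
  rcases (norm_nonneg (I.toOp x ξ)).eq_or_lt with h0 | h0
  · rw [← h0]
    exact norm_nonneg x
  · exact le_of_mul_le_mul_left h h0

theorem NormLE.norm_le {x : H →L[ℂ] H} {r : ℝ} (h : I.NormLE x r) : ‖x‖ ≤ r := by
  obtain ⟨y, rfl, h⟩ := h
  exact (norm_toOp_le y).trans h

/-- The inclusion of the ideal into `B(H)`, as a continuous linear map. -/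
noncomputable def toOpL (I : SymmetricallyNormedIdeal H) : I.Space →L[ℂ] (H →L[ℂ] H) :=
  LinearMap.mkContinuous
    { toFun := I.toOp
      map_add' := fun _ _ => rfl
      map_smul' := fun _ _ => rfl } 1 fun x => by
    rw [one_mul]
    exact norm_toOp_le x

theorem toOpL_apply (x : I.Space) : I.toOpL x = I.toOp x := rfl

theorem normClosure_subset_closure (S : Set (H →L[ℂ] H)) : I.normClosure S ⊆ closure S := by
  rintro _ ⟨y, hy, rfl⟩
  exact map_mem_closure (f := I.toOpL) I.toOpL.continuous hy fun z hz => hz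

variable [CompleteSpace H]

theorem finiteRankIdeal_le (hI : I.ideal ≠ ⊥) : finiteRankIdeal H ≤ I.ideal := by
  intro x hx
  refine Submodule.span_induction (p := fun y _ => y ∈ I.ideal) ?_ I.ideal.zero_mem
    (fun y z _ _ hy hz => I.ideal.add_mem hy hz) (fun c y _ hy => ?_)
    (mem_span_rankOne_of_mem_finiteRankIdeal hx)
  · rintro _ ⟨p, rfl⟩
    exact rankOne_mem hI p.1 p.2
  · simpa using I.ideal.mul_mem_left (c • (1 : H →L[ℂ] H)) hy

end RankOne

end SymmetricallyNormedIdeal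

/-! ### Contractions, and the pigeonhole principle in separable spaces -/

section Unitary

variable {H : Type*} [NormedAddCommGroup H] [InnerProductSpace ℂ H]

theorem norm_one_sub_starProjection_le (E : Submodule ℂ H) [E.HasOrthogonalProjection] :
    ‖1 - E.starProjection‖ ≤ 1 := by
  rw [← Submodule.starProjection_orthogonal']
  exact Submodule.starProjection_norm_le _

variable [CompleteSpace H]

theorem star_starProjection (E : Submodule ℂ H) [E.HasOrthogonalProjection] :
    star E.starProjection = E.starProjection :=
  isSelfAdjoint_starProjection E

theorem norm_le_one_of_mem_unitary {u : H →L[ℂ] H} (hu : u ∈ unitary (H →L[ℂ] H)) : ‖u‖ ≤ 1 :=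
  norm_le_one_of_star_mul_self (Unitary.star_mul_self_of_mem hu)

theorem norm_star_le_one_of_mem_unitary {u : H →L[ℂ] H} (hu : u ∈ unitary (H →L[ℂ] H)) :
    ‖star u‖ ≤ 1 := norm_le_one_of_mem_unitary (Unitary.star_mem hu)

end Unitary

theorem exists_ne_norm_sub_le {X : Type*} [NormedAddCommGroup X] [TopologicalSpace.SeparableSpace X]
    (g : (ℕ → Bool) → X) {δ : ℝ} (hδ : 0 < δ) : ∃ t t', t ≠ t' ∧ ‖g t - g t'‖ ≤ δ := by
  by_contra! h
  have hc : Countable (ℕ → Bool) := by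
    refine Pairwise.countable_of_isOpen_disjoint (s := fun t => Metric.ball (g t) (δ / 2)) ?_
      (fun t => Metric.isOpen_ball) fun t => ⟨g t, Metric.mem_ball_self (half_pos hδ)⟩
    intro t t' htt
    refine Metric.ball_disjoint_ball ?_
    rw [dist_eq_norm, add_halves]
    exact (h t t' htt).le
  -- Cantor's diagonal argument.
  obtain ⟨f, hf⟩ := exists_surjective_nat (ℕ → Bool)
  obtain ⟨n, hn⟩ := hf fun n => !(f n n)
  have := congrFun hn n
  simp at this

/-! ### From separability to closures of orbits -/

namespace SymmetricallyNormedIdeal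

variable {H : Type*} [NormedAddCommGroup H] [InnerProductSpace ℂ H] [CompleteSpace H]
  {I : SymmetricallyNormedIdeal H}

theorem NormLE.conj {x u : H →L[ℂ] H} {r : ℝ} (hx : I.NormLE x r)
    (hu : u ∈ unitary (H →L[ℂ] H)) : I.NormLE (u * x * star u) r := by
  simpa using hx.mul_mul (norm_le_one_of_mem_unitary hu) (norm_star_le_one_of_mem_unitary hu)

theorem exists_finiteRank_left [TopologicalSpace.SeparableSpace I.Space] (b : HilbertBasis ℕ ℂ H)
    {x : H →L[ℂ] H} (hx : x ∈ I.ideal) {δ : ℝ} (hδ : 0 < δ) :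
    ∃ f ∈ finiteRankIdeal H, I.NormLE (x - f * x) δ := by
  obtain ⟨v, hv, hvF⟩ := exists_almost_orthogonal_isometries b
  choose g hg using fun t => exists_toOp_eq (I.ideal.mul_mem_left (v t) hx)
  obtain ⟨t, t', htt, h⟩ := exists_ne_norm_sub_le g hδ
  refine ⟨star (v t) * v t', hvF t t' htt, ?_⟩
  have h1 : I.NormLE (v t * x - v t' * x) δ := ⟨g t - g t', by rw [← hg, ← hg]; rfl, h⟩
  have h2 := h1.mul_left (a := star (v t))
    ((norm_star (v t)).trans_le (norm_le_one_of_star_mul_self (hv t)))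
  rwa [one_mul, mul_sub, ← mul_assoc, ← mul_assoc, hv, one_mul] at h2

theorem exists_finiteRank_right [TopologicalSpace.SeparableSpace I.Space] (b : HilbertBasis ℕ ℂ H)
    {x : H →L[ℂ] H} (hx : x ∈ I.ideal) {δ : ℝ} (hδ : 0 < δ) :
    ∃ f ∈ finiteRankIdeal H, I.NormLE (x - x * star f) δ := by
  obtain ⟨v, hv, hvF⟩ := exists_almost_orthogonal_isometries b
  have hmem : ∀ t, x * star (v t) ∈ I.ideal := fun t => by simpa using mul_mem 1 (star (v t)) hx
  choose g hg using fun t => exists_toOp_eq (hmem t)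
  obtain ⟨t, t', htt, h⟩ := exists_ne_norm_sub_le g hδ
  refine ⟨star (v t) * v t', hvF t t' htt, ?_⟩
  have h1 : I.NormLE (x * star (v t) - x * star (v t')) δ :=
    ⟨g t - g t', by rw [← hg, ← hg]; rfl, h⟩
  have h2 := h1.mul_right (norm_le_one_of_star_mul_self (hv t))
  rwa [mul_one, sub_mul, mul_assoc, mul_assoc, hv, mul_one, ← star_star (v t), ← star_mul] at h2

theorem exists_starProjection_approx [TopologicalSpace.SeparableSpace I.Space]
    (b : HilbertBasis ℕ ℂ H) {x : H →L[ℂ] H} (hx : x ∈ I.ideal) {δ : ℝ} (hδ : 0 < δ) :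
    ∃ (E : Submodule ℂ H) (_ : FiniteDimensional ℂ E),
      I.NormLE ((1 - E.starProjection) * x) δ ∧ I.NormLE (x * (1 - E.starProjection)) δ := by
  obtain ⟨f, hf, hfx⟩ := exists_finiteRank_left b hx hδ
  obtain ⟨g, hg, hgx⟩ := exists_finiteRank_right b hx hδ
  have : FiniteDimensional ℂ (LinearMap.range (f : H →ₗ[ℂ] H)) := hf
  have : FiniteDimensional ℂ (LinearMap.range (g : H →ₗ[ℂ] H)) := hg
  -- The projection `P` onto `E` fixes `f` and `g` on the left, so `(1 - P) * x = (1 - P) * (x - f *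
  -- x)`, and similarly on the right.
  let E := LinearMap.range (f : H →ₗ[ℂ] H) ⊔ LinearMap.range (g : H →ₗ[ℂ] H)
  have hEf : E.starProjection * f = f := by
    ext y
    exact Submodule.starProjection_eq_self_iff.2 (Submodule.mem_sup_left ⟨y, rfl⟩)
  have hEg : star g * E.starProjection = star g := by
    have h : E.starProjection * g = g := by
      ext y
      exact Submodule.starProjection_eq_self_iff.2 (Submodule.mem_sup_right ⟨y, rfl⟩)
    have := congrArg star h
    rwa [star_mul, star_starProjection] at this
  refine ⟨E, inferInstance, ?_, ?_⟩
  · have h := hfx.mul_left (norm_one_sub_starProjection_le E)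
    rwa [one_mul, mul_sub, ← mul_assoc, sub_mul 1 _ f, hEf, one_mul, sub_self, zero_mul,
      sub_zero] at h
  · have h := hgx.mul_right (norm_one_sub_starProjection_le E)
    rwa [mul_one, sub_mul, mul_assoc x, mul_sub (star g), hEg, mul_one, sub_self, mul_zero,
      sub_zero] at h

theorem unitaryOrbit_subset_ideal (J : Ideal (H →L[ℂ] H)) {a : H →L[ℂ] H} (ha : a ∈ I.ideal) :
    ∀ x ∈ unitaryOrbit J a, x ∈ I.ideal := by
  rintro _ ⟨u, -, rfl⟩
  exact mul_mem _ _ ha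

theorem unitaryOrbit_top_subset [TopologicalSpace.SeparableSpace I.Space]
    (b : HilbertBasis ℕ ℂ H) {a : H →L[ℂ] H} (ha : a ∈ I.ideal) :
    unitaryOrbit ⊤ a ⊆ I.normClosure (unitaryOrbit (finiteRankIdeal H) a) := by
  rintro _ ⟨u, ⟨hu, -⟩, rfl⟩
  refine mem_normClosure.2 ⟨mul_mem _ _ ha, fun ε hε => ?_⟩
  obtain ⟨E, _, h1, h2⟩ := exists_starProjection_approx b ha (by positivity : 0 < ε / 4)
  obtain ⟨w, hw, hwu⟩ := exists_unitary_eqOn E hu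
  set P := E.starProjection
  have h3 : I.NormLE (a - P * a * P) (ε / 2) := by
    have h := h1.add (h2.mul_left E.starProjection_norm_le)
    have h4 : (1 - P) * a + P * (a * (1 - P)) = a - P * a * P := by noncomm_ring
    rw [h4] at h
    exact h.mono (by linarith)
  have hwP : w * P = u * P := by
    ext y
    exact hwu _ (E.starProjection_apply_mem y)
  have hPw : P * star w = P * star u := by
    have h := congrArg star hwP
    rwa [star_mul, star_mul, star_starProjection] at h
  have h5 := (h3.conj hu).sub (h3.conj hw.1)
  have h6 : w * (P * a * P) * star w = u * (P * a * P) * star u := by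
    calc w * (P * a * P) * star w = (w * P) * a * (P * star w) := by noncomm_ring
      _ = u * (P * a * P) * star u := by rw [hwP, hPw]; noncomm_ring
  refine ⟨w * a * star w, ⟨w, hw, rfl⟩, mul_mem _ _ ha, ?_⟩
  rw [mul_sub, sub_mul, mul_sub w, sub_mul, h6, sub_sub_sub_cancel_right, add_halves] at h5
  exact h5

/-- Up to small errors `x` and `y` live on the rotated projections `Q` and `Q'`, whose ideal norms
are bounded by the same `N` throughout the orbit. There the ideal norm of `x - y` is controlled by
`N` times its operator norm. -/
theorem exists_normLE_of_norm_sub_le [TopologicalSpace.SeparableSpace I.Space]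
    (b : HilbertBasis ℕ ℂ H) (hI : I.ideal ≠ ⊥) {a : H →L[ℂ] H} (ha : a ∈ I.ideal) {ε : ℝ}
    (hε : 0 < ε) : ∃ η > 0, ∀ x ∈ unitaryOrbit ⊤ a, ∀ y ∈ unitaryOrbit ⊤ a, ‖x - y‖ ≤ η →
      I.NormLE (x - y) ε := by
  obtain ⟨E, _, h1, h2⟩ := exists_starProjection_approx b ha (by positivity : 0 < ε / 5)
  set P := E.starProjection with hP
  obtain ⟨N, hN0, hN⟩ := exists_normLE
    (finiteRankIdeal_le hI (starProjection_mem_finiteRankIdeal E))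
  refine ⟨ε / 5 / (N + 1), by positivity, ?_⟩
  rintro x ⟨u, ⟨hu, -⟩, hx⟩ y ⟨u', ⟨hu', -⟩, hy⟩ hxy
  have hxy' : ‖y - x‖ ≤ ε / 5 / (N + 1) := by rwa [norm_sub_rev]
  have hNε : N * (ε / 5 / (N + 1)) ≤ ε / 5 := by
    rw [mul_div_assoc', div_le_iff₀ (by positivity)]
    nlinarith
  set Q := u * P * star u with hQ
  set Q' := u' * P * star u' with hQ'
  have hconj : ∀ v ∈ unitary (H →L[ℂ] H), ∀ c d : H →L[ℂ] H,
      (v * c * star v) * (v * d * star v) = v * (c * d) * star v := by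
    intro v hv c d
    calc (v * c * star v) * (v * d * star v) = v * c * (star v * v) * d * star v := by noncomm_ring
      _ = v * (c * d) * star v := by rw [Unitary.star_mul_self_of_mem hv]; noncomm_ring
  have hone : ∀ v ∈ unitary (H →L[ℂ] H), 1 - v * P * star v = v * (1 - P) * star v := by
    intro v hv
    rw [mul_sub, sub_mul, mul_one, Unitary.mul_star_self_of_mem hv]
  have hQ1 : ‖1 - Q‖ ≤ 1 := by
    rw [hQ, hone u hu]
    calc ‖u * (1 - P) * star u‖ ≤ ‖u‖ * ‖1 - P‖ * ‖star u‖ :=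
          (norm_mul_le _ _).trans (by gcongr; exact norm_mul_le _ _)
      _ ≤ 1 * 1 * 1 := by
          gcongr
          · exact norm_le_one_of_mem_unitary hu
          · exact norm_one_sub_starProjection_le E
          · exact norm_star_le_one_of_mem_unitary hu
      _ = 1 := by norm_num
  have hQ'1 : ‖Q'‖ ≤ 1 := by
    calc ‖u' * P * star u'‖ ≤ ‖u'‖ * ‖P‖ * ‖star u'‖ :=
          (norm_mul_le _ _).trans (by gcongr; exact norm_mul_le _ _)
      _ ≤ 1 * 1 * 1 := by
          gcongr
          · exact norm_le_one_of_mem_unitary hu'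
          · exact E.starProjection_norm_le
          · exact norm_star_le_one_of_mem_unitary hu'
      _ = 1 := by norm_num
  have t1 : I.NormLE (Q * (x - y)) (ε / 5) := ((hN.conj hu).mul_right hxy).mono hNε
  have t2 : I.NormLE ((1 - Q) * x) (ε / 5) := by
    rw [hQ, hone u hu, hx, hconj u hu]
    exact h1.conj hu
  have t3 : I.NormLE ((1 - Q) * (y * (1 - Q'))) (ε / 5) := by
    have h : I.NormLE (y * (1 - Q')) (ε / 5) := by
      rw [hQ', hone u' hu', hy, hconj u' hu']
      exact h2.conj hu'
    simpa using h.mul_left hQ1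
  have t4 : I.NormLE ((1 - Q) * ((y - x) * Q')) (ε / 5) := by
    have h : I.NormLE ((y - x) * Q') (ε / 5) :=
      ((hN.conj hu').mul_left hxy').mono (by rwa [mul_comm])
    simpa using h.mul_left hQ1
  have t5 : I.NormLE ((1 - Q) * x * Q') (ε / 5) := by simpa using t2.mul_right hQ'1
  -- Write `x - y` as `Q (x - y) + (1 - Q) x - (1 - Q) y` and split the last term by `Q'` and `y =
  -- (y - x) + x`. This gives five pieces of size `ε / 5`.
  have h := (((t1.add t2).sub t3).sub t4).sub t5
  have hid : Q * (x - y) + (1 - Q) * x - (1 - Q) * (y * (1 - Q')) - (1 - Q) * ((y - x) * Q') -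
      (1 - Q) * x * Q' = x - y := by noncomm_ring
  rw [hid] at h
  exact h.mono (by linarith)

/-- An operator-norm Cauchy sequence in the orbit is Cauchy in the ideal norm; both limits coincide
because the inclusion is continuous. -/
theorem closure_unitaryOrbit_top_subset [TopologicalSpace.SeparableSpace I.Space]
    (b : HilbertBasis ℕ ℂ H) (hI : I.ideal ≠ ⊥) {a : H →L[ℂ] H} (ha : a ∈ I.ideal) :
    closure (unitaryOrbit ⊤ a) ⊆ I.normClosure (unitaryOrbit ⊤ a) := by
  intro x hx
  obtain ⟨c, hc, hcx⟩ := mem_closure_iff_seq_limit.1 hx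
  choose g hg using fun n => exists_toOp_eq (unitaryOrbit_subset_ideal ⊤ ha (c n) (hc n))
  have hcauchy : CauchySeq g := by
    refine Metric.cauchySeq_iff.2 fun ε hε => ?_
    obtain ⟨η, hη, h⟩ := exists_normLE_of_norm_sub_le b hI ha (half_pos hε)
    obtain ⟨N, hN⟩ := Metric.cauchySeq_iff.1 hcx.cauchySeq η hη
    refine ⟨N, fun m hm n hn => ?_⟩
    have h1 := h (c m) (hc m) (c n) (hc n) (by rw [← dist_eq_norm]; exact (hN m hm n hn).le)
    rw [← hg, ← hg] at h1
    have h2 : ‖g m - g n‖ ≤ ε / 2 := normLE_toOp_iff.1 h1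
    rw [dist_eq_norm]
    linarith
  have := I.complete
  obtain ⟨y, hy⟩ := cauchySeq_tendsto_of_complete hcauchy
  refine ⟨y, mem_closure_of_tendsto hy (Filter.Eventually.of_forall fun n => ?_), ?_⟩
  · change I.toOp (g n) ∈ unitaryOrbit ⊤ a
    rw [hg]
    exact hc n
  · refine tendsto_nhds_unique ((I.toOpL.continuous.tendsto y).comp hy) ?_
    have : I.toOpL ∘ g = c := funext hg
    rwa [this]

end SymmetricallyNormedIdeal

/-! ### From the orbit condition to separability -/

namespace SymmetricallyNormedIdeal

variable {H : Type*} [NormedAddCommGroup H] [InnerProductSpace ℂ H]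
  {I : SymmetricallyNormedIdeal H}

/-- This and the next two lemmas show the ideal-norm closure of the finite-rank operators to be
closed under sums and two-sided multiplication. -/
theorem sub_mem_normClosure_finiteRank {x y : H →L[ℂ] H}
    (hx : x ∈ I.normClosure (finiteRankIdeal H)) (hy : y ∈ I.normClosure (finiteRankIdeal H)) :
    x - y ∈ I.normClosure (finiteRankIdeal H) := by
  rw [mem_normClosure] at hx hy ⊢
  refine ⟨I.ideal.sub_mem hx.1 hy.1, fun ε hε => ?_⟩
  obtain ⟨f, hf, hfI, hfx⟩ := hx.2 (ε / 2) (half_pos hε)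
  obtain ⟨g, hg, hgI, hgy⟩ := hy.2 (ε / 2) (half_pos hε)
  refine ⟨f - g, (finiteRankIdeal H).sub_mem hf hg, I.ideal.sub_mem hfI hgI, ?_⟩
  have := hfx.sub hgy
  rwa [add_halves, sub_sub_sub_comm] at this

theorem mul_mem_normClosure_finiteRank (c d : H →L[ℂ] H) {x : H →L[ℂ] H}
    (hx : x ∈ I.normClosure (finiteRankIdeal H)) :
    c * x * d ∈ I.normClosure (finiteRankIdeal H) := by
  rw [mem_normClosure] at hx ⊢
  refine ⟨mul_mem c d hx.1, fun ε hε => ?_⟩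
  obtain ⟨f, hf, hfI, hfx⟩ := hx.2 (ε / (‖c‖ * ‖d‖ + 1)) (by positivity)
  refine ⟨c * f * d, finiteRankIdeal_mul_right ((finiteRankIdeal H).mul_mem_left c hf) d,
    mul_mem c d hfI, ?_⟩
  have h := hfx.mul_mul (le_refl ‖c‖) (le_refl ‖d‖)
  rw [mul_sub, sub_mul] at h
  refine h.mono ?_
  rw [mul_div_assoc', div_mul_eq_mul_div, div_le_iff₀ (by positivity)]
  nlinarith

theorem add_mem_normClosure_finiteRank {x y : H →L[ℂ] H}
    (hx : x ∈ I.normClosure (finiteRankIdeal H)) (hy : y ∈ I.normClosure (finiteRankIdeal H)) :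
    x + y ∈ I.normClosure (finiteRankIdeal H) := by
  have h := sub_mem_normClosure_finiteRank hx (mul_mem_normClosure_finiteRank (-1) 1 hy)
  simpa using h

/-- The expansion `x = ∑ (x b_k) ⊗ b_k` converges absolutely in the ideal norm. -/
theorem mem_normClosure_finiteRank_of_norm_basis_le (hI0 : I.ideal ≠ ⊥) (b : HilbertBasis ℕ ℂ H)
    {x : H →L[ℂ] H} (hx : ∀ k, ‖x (b k)‖ ≤ (1 / 2) ^ k) :
    x ∈ I.normClosure (finiteRankIdeal H) := by
  choose g hg hgn using fun k => normLE_rankOne hI0 (x (b k)) (b k)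
  have := I.complete
  have hsum : Summable g := by
    refine Summable.of_norm_bounded summable_geometric_two fun k => (hgn k).trans ?_
    rw [b.orthonormal.1, mul_one]
    exact hx k
  have hs := hsum.hasSum
  refine ⟨∑' k, g k, mem_closure_of_tendsto hs (Filter.Eventually.of_forall fun s => ?_), ?_⟩
  · change I.toOpL (∑ k ∈ s, g k) ∈ finiteRankIdeal H
    rw [map_sum]
    refine (finiteRankIdeal H).sum_mem fun k _ => ?_
    rw [toOpL_apply, hg]
    refine mem_finiteRankIdeal_of_range_le (Submodule.span ℂ {x (b k)}) fun y => ?_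
    exact Submodule.smul_mem _ _ (Submodule.mem_span_singleton_self _)
  · refine ContinuousLinearMap.ext_on (s := Set.range b) ?_ ?_
    · rw [Submodule.dense_iff_topologicalClosure_eq_top, b.dense_span]
    rintro _ ⟨j, rfl⟩
    have h1 : HasSum (fun k => I.toOp (g k) (b j)) (I.toOp (∑' k, g k) (b j)) :=
      (hs.mapL I.toOpL).mapL (ContinuousLinearMap.apply ℂ H (b j))
    refine h1.unique ?_
    have h2 : ∀ k, k ≠ j → I.toOp (g k) (b j) = 0 := by
      intro k hk
      rw [hg, InnerProductSpace.rankOne_apply, b.orthonormal.2 hk, zero_smul]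
    have h3 : I.toOp (g j) (b j) = x (b j) := by
      rw [hg, InnerProductSpace.rankOne_apply, inner_self_eq_norm_sq_to_K, b.orthonormal.1]
      simp
    simpa [h3] using hasSum_single j h2

variable [CompleteSpace H]

/-- By linearity `x` may be a unitary `u`. Then `u * a * star u - a` is a limit of the finite-rank
operators `w * a * star w - a` with `w ∈ 1 + F`; multiply by `u` on the right. -/
theorem commutator_mem_normClosure_finiteRank {a : H →L[ℂ] H} (ha : a ∈ I.ideal)
    (h : unitaryOrbit ⊤ a ⊆ I.normClosure (unitaryOrbit (finiteRankIdeal H) a))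
    (x : H →L[ℂ] H) : x * a - a * x ∈ I.normClosure (finiteRankIdeal H) := by
  have hx : x ∈ Submodule.span ℂ (unitary (H →L[ℂ] H) : Set (H →L[ℂ] H)) := by
    rw [CStarAlgebra.span_unitary]
    trivial
  induction hx using Submodule.span_induction with
  | mem u hu =>
    have hua : u * a * star u - a ∈ I.normClosure (finiteRankIdeal H) := by
      refine mem_normClosure.2 ⟨I.ideal.sub_mem (mul_mem _ _ ha) ha, fun ε hε => ?_⟩
      obtain ⟨_, ⟨w, hw, rfl⟩, hwI, hwε⟩ := (mem_normClosure.1 (h ⟨u, ⟨hu, trivial⟩, rfl⟩)).2 ε hε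
      refine ⟨w * a * star w - a, ?_, I.ideal.sub_mem hwI ha, by rwa [sub_sub_sub_cancel_right]⟩
      have h1 : w * a * star w - a = (w - 1) * (a * star w) - (a * star w) * (w - 1) := by
        calc w * a * star w - a = w * a * star w - a * (star w * w) := by
              rw [Unitary.star_mul_self_of_mem hw.1, mul_one]
          _ = _ := by noncomm_ring
      rw [h1]
      exact (finiteRankIdeal H).sub_mem (finiteRankIdeal_mul_right hw.2 _)
        ((finiteRankIdeal H).mul_mem_left _ hw.2)
    have h2 := mul_mem_normClosure_finiteRank 1 u hua
    rwa [one_mul, sub_mul, mul_assoc _ (star u), Unitary.star_mul_self_of_mem hu, mul_one] at h2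
  | zero =>
    rw [zero_mul, mul_zero, sub_zero]
    exact mem_normClosure.2 ⟨I.ideal.zero_mem, fun ε hε =>
      ⟨0, (finiteRankIdeal H).zero_mem, I.ideal.zero_mem, 0, (sub_zero 0).symm,
        by simpa using hε.le⟩⟩
  | add y z _ _ hy hz =>
    have h3 : (y + z) * a - a * (y + z) = (y * a - a * y) + (z * a - a * z) := by noncomm_ring
    rw [h3]
    exact add_mem_normClosure_finiteRank hy hz
  | smul c y _ hy =>
    have h4 := mul_mem_normClosure_finiteRank (c • 1) 1 hy
    simpa [mul_sub, smul_sub] using h4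

/-- If `a` were bounded below on `Eᗮ`, Douglas factorization would put the projection onto `Eᗮ` in
the ideal, and adding the finite-rank projection onto `E` would give `1`. -/
theorem exists_mem_orthogonal_norm_le (hI0 : I.ideal ≠ ⊥) (hI : I.ideal ≠ ⊤) {a : H →L[ℂ] H}
    (ha : a ∈ I.ideal) (E : Submodule ℂ H) [FiniteDimensional ℂ E] {c : ℝ} (hc : 0 < c) :
    ∃ f ∈ Eᗮ, ‖f‖ = 1 ∧ ‖a f‖ ≤ c := by
  by_contra! h
  have hbd : ∀ x, ‖Eᗮ.starProjection x‖ ≤ c⁻¹ * ‖(a * Eᗮ.starProjection) x‖ := by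
    intro x
    set y := Eᗮ.starProjection x
    rcases eq_or_ne y 0 with hy | hy
    · rw [hy, norm_zero]
      positivity
    have hy0 : 0 < ‖y‖ := norm_pos_iff.2 hy
    have h1 := h (((‖y‖⁻¹ : ℝ) : ℂ) • y) (Eᗮ.smul_mem _ (Eᗮ.starProjection_apply_mem x)) (by
      rw [norm_smul, Complex.norm_real, norm_inv, norm_norm, inv_mul_cancel₀ hy0.ne'])
    rw [map_smul, norm_smul, Complex.norm_real, norm_inv, norm_norm, ← div_eq_inv_mul,
      lt_div_iff₀ hy0] at h1
    change ‖y‖ ≤ c⁻¹ * ‖a y‖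
    rw [← div_eq_inv_mul, le_div_iff₀ hc, mul_comm]
    exact h1.le
  obtain ⟨C, hC⟩ := exists_eq_mul_of_norm_le _ hbd
  refine hI ((Ideal.eq_top_iff_one _).2 ?_)
  have h2 : Eᗮ.starProjection ∈ I.ideal := by
    rw [hC, ← mul_assoc]
    exact mul_mem C _ ha
  have h3 := I.ideal.add_mem h2 (finiteRankIdeal_le hI0 (starProjection_mem_finiteRankIdeal E))
  rwa [Submodule.starProjection_orthogonal', sub_add_cancel] at h3

theorem exists_orthonormal_norm_le (hI0 : I.ideal ≠ ⊥) (hI : I.ideal ≠ ⊤) {a : H →L[ℂ] H}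
    (ha : a ∈ I.ideal) : ∃ f : ℕ → H, Orthonormal ℂ f ∧ ∀ k, ‖a (f k)‖ ≤ (1 / 2) ^ k := by
  -- Each vector carries its exponent. The exponents strictly increase, so the `n`-th is at least
  -- `n`.
  obtain ⟨g, hg, hgr⟩ := exists_seq_of_forall_finset_exists
    (fun p : ℕ × H => ‖p.2‖ = 1 ∧ ‖a p.2‖ ≤ (1 / 2) ^ p.1)
    (fun p q : ℕ × H => p.1 < q.1 ∧ ⟪p.2, q.2⟫_ℂ = 0) (by
      intro s _
      have : FiniteDimensional ℂ (Submodule.span ℂ (Prod.snd '' (s : Set (ℕ × H)))) :=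
        FiniteDimensional.span_of_finite ℂ (s.finite_toSet.image _)
      obtain ⟨f, hf, hf1, hfa⟩ := exists_mem_orthogonal_norm_le hI0 hI ha
        (Submodule.span ℂ (Prod.snd '' (s : Set (ℕ × H))))
        (c := (1 / 2) ^ (s.sup Prod.fst + 1)) (by positivity)
      refine ⟨(s.sup Prod.fst + 1, f), ⟨hf1, hfa⟩, fun p hp => ⟨?_, ?_⟩⟩
      · exact Nat.lt_succ_of_le (Finset.le_sup (f := Prod.fst) hp)
      · have hps : p.2 ∈ Submodule.span ℂ (Prod.snd '' (s : Set (ℕ × H))) :=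
          Submodule.subset_span ⟨p, hp, rfl⟩
        exact Submodule.inner_right_of_mem_orthogonal hps hf)
  have hmono : StrictMono fun n => (g n).1 := fun m n h => (hgr m n h).1
  refine ⟨fun n => (g n).2, ⟨fun n => (hg n).1, fun m n hmn => ?_⟩, fun k => (hg k).2.trans ?_⟩
  · rcases lt_or_gt_of_ne hmn with h | h
    · exact (hgr m n h).2
    · exact inner_eq_zero_symm.1 (hgr n m h).2
  · exact pow_le_pow_of_le_one (by norm_num) (by norm_num) (hmono.le_apply)

theorem mem_normClosure_finiteRank_of_unitaryOrbit_subset (hI0 : I.ideal ≠ ⊥) (hI : I.ideal ≠ ⊤)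
    (b : HilbertBasis ℕ ℂ H) {a : H →L[ℂ] H} (ha : a ∈ I.ideal)
    (h : unitaryOrbit ⊤ a ⊆ I.normClosure (unitaryOrbit (finiteRankIdeal H) a)) :
    a ∈ I.normClosure (finiteRankIdeal H) := by
  obtain ⟨f, hf, hfa⟩ := exists_orthonormal_norm_le hI0 hI ha
  obtain ⟨v, hv, hvb⟩ := exists_isometry_map_basis b hf
  have h1 : a * v ∈ I.normClosure (finiteRankIdeal H) :=
    mem_normClosure_finiteRank_of_norm_basis_le hI0 b fun k => by
      simpa [hvb] using hfa k
  have h2 := add_mem_normClosure_finiteRank (commutator_mem_normClosure_finiteRank ha h v) h1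
  have h3 := mul_mem_normClosure_finiteRank (star v) 1 h2
  rwa [sub_add_cancel, mul_one, ← mul_assoc, hv, one_mul] at h3

theorem norm_abs_apply (x : H →L[ℂ] H) (y : H) : ‖CFC.abs x y‖ = ‖x y‖ := by
  have hsa : star (CFC.abs x) = CFC.abs x := (CFC.abs_nonneg x).isSelfAdjoint
  have h1 : star (CFC.abs x) * CFC.abs x = star x * x := by rw [hsa, CFC.abs_mul_abs]
  have h2 : ‖CFC.abs x y‖ ^ 2 = ‖x y‖ ^ 2 := by
    rw [ContinuousLinearMap.apply_norm_sq_eq_inner_adjoint_left,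
      ContinuousLinearMap.apply_norm_sq_eq_inner_adjoint_left]
    exact congrArg (fun z : H →L[ℂ] H => RCLike.re ⟪z y, y⟫_ℂ) h1
  exact (sq_eq_sq₀ (norm_nonneg _) (norm_nonneg _)).1 h2

theorem ideal_subset_normClosure_finiteRank (hI0 : I.ideal ≠ ⊥) (hI : I.ideal ≠ ⊤)
    (b : HilbertBasis ℕ ℂ H)
    (h : ∀ a ∈ I.ideal, a.IsPositive →
      unitaryOrbit ⊤ a ⊆ I.normClosure (unitaryOrbit (finiteRankIdeal H) a))
    {x : H →L[ℂ] H} (hx : x ∈ I.ideal) : x ∈ I.normClosure (finiteRankIdeal H) := by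
  obtain ⟨C, hC⟩ := exists_eq_mul_of_norm_le (A := x) (B := CFC.abs x) 1 fun y => by
    rw [norm_abs_apply, one_mul]
  obtain ⟨D, hD⟩ := exists_eq_mul_of_norm_le (A := CFC.abs x) (B := x) 1 fun y => by
    rw [norm_abs_apply, one_mul]
  have h1 : CFC.abs x ∈ I.ideal := by
    rw [hD]
    exact I.ideal.mul_mem_left D hx
  have h2 := mem_normClosure_finiteRank_of_unitaryOrbit_subset hI0 hI b h1
    (h _ h1 ((ContinuousLinearMap.nonneg_iff_isPositive _).1 (CFC.abs_nonneg x)))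
  have h3 := mul_mem_normClosure_finiteRank C 1 h2
  rwa [mul_one, ← hC] at h3

/-- Rank-one operators form a continuous image of the separable space `H × H`, and their closed span
is the whole ideal. -/
theorem separableSpace_of_subset_normClosure_finiteRank [TopologicalSpace.SeparableSpace H]
    (hI0 : I.ideal ≠ ⊥) (h : ∀ x ∈ I.ideal, x ∈ I.normClosure (finiteRankIdeal H)) :
    TopologicalSpace.SeparableSpace I.Space := by
  choose G hG using fun p : H × H => exists_toOp_eq (rankOne_mem hI0 p.1 p.2)
  have hcont : Continuous G := by
    refine continuous_iff_continuousAt.2 fun p => tendsto_iff_norm_sub_tendsto_zero.2 ?_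
    have hb : ∀ q : H × H, ‖G q - G p‖ ≤ ‖q.1 - p.1‖ * ‖q.2‖ + ‖p.1‖ * ‖q.2 - p.2‖ := by
      intro q
      have h1 := (normLE_rankOne hI0 (q.1 - p.1) q.2).add (normLE_rankOne hI0 p.1 (q.2 - p.2))
      have h2 : InnerProductSpace.rankOne ℂ (q.1 - p.1) q.2 +
          InnerProductSpace.rankOne ℂ p.1 (q.2 - p.2) = I.toOp (G q - G p) := by
        change _ = I.toOp (G q) - I.toOp (G p)
        rw [hG, hG]
        simp
      rw [h2] at h1
      exact normLE_toOp_iff.1 h1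
    refine squeeze_zero (fun q => norm_nonneg _) hb ?_
    have hc : Continuous fun q : H × H => ‖q.1 - p.1‖ * ‖q.2‖ + ‖p.1‖ * ‖q.2 - p.2‖ := by fun_prop
    have := hc.tendsto p
    simpa using this
  have hsep : TopologicalSpace.IsSeparable
      (closure (Submodule.span ℂ (Set.range G) : Set I.Space)) :=
    ((TopologicalSpace.isSeparable_range hcont).span (R := ℂ)).closure
  rw [← TopologicalSpace.isSeparable_univ_iff]
  refine hsep.mono fun y _ => ?_
  obtain ⟨y', hy', hyy⟩ := h (I.toOp y) (toOp_mem y)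
  rw [toOp_injective hyy] at hy'
  refine closure_mono (fun z hz => ?_) hy'
  have h1 := mem_span_rankOne_of_mem_finiteRankIdeal hz
  have h2 : (Set.range fun p : H × H => (InnerProductSpace.rankOne ℂ p.1 p.2 : H →L[ℂ] H)) =
      (I.toOpL : I.Space →ₗ[ℂ] (H →L[ℂ] H)) '' Set.range G := by
    rw [← Set.range_comp]
    exact congrArg Set.range (funext fun p => (hG p).symm)
  rw [h2, ← Submodule.map_span] at h1
  obtain ⟨z', hz', hzz⟩ := h1
  rwa [← toOp_injective hzz]

end SymmetricallyNormedIdeal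

/-! ### The zero ideal and the final equivalence -/

theorem unitaryOrbit_zero {H : Type*} [NormedAddCommGroup H] [InnerProductSpace ℂ H]
    [CompleteSpace H] (J : Ideal (H →L[ℂ] H)) : unitaryOrbit J (0 : H →L[ℂ] H) = {0} := by
  ext x
  constructor
  · rintro ⟨u, -, rfl⟩
    simp
  · rintro rfl
    exact ⟨1, ⟨one_mem _, by simp⟩, by simp⟩

theorem unitaryOrbit_mono {H : Type*} [NormedAddCommGroup H] [InnerProductSpace ℂ H]
    [CompleteSpace H] {J K : Ideal (H →L[ℂ] H)} (h : J ≤ K) (a : H →L[ℂ] H) :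
    unitaryOrbit J a ⊆ unitaryOrbit K a := by
  rintro _ ⟨u, hu, rfl⟩
  exact ⟨u, ⟨hu.1, h hu.2⟩, rfl⟩

theorem SymmetricallyNormedIdeal.normClosure_singleton_zero {H : Type*} [NormedAddCommGroup H]
    [InnerProductSpace ℂ H] (I : SymmetricallyNormedIdeal H) :
    I.normClosure {(0 : H →L[ℂ] H)} = {0} := by
  have h : I.toOp ⁻¹' {(0 : H →L[ℂ] H)} = {0} := by
    ext x
    exact ⟨fun hx => toOp_injective hx, fun hx => congrArg I.toOp hx⟩
  unfold NormedOperatorIdeal.normClosure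
  rw [h, closure_singleton, Set.image_singleton]
  rfl

theorem mainTheorem6 {H : Type*} [NormedAddCommGroup H] [InnerProductSpace ℂ H] [CompleteSpace H]
    [TopologicalSpace.SeparableSpace H] (hH : ¬ FiniteDimensional ℂ H)
    (I : SymmetricallyNormedIdeal H) (hI : I.ideal ≠ ⊤) :
    List.TFAE [
      TopologicalSpace.SeparableSpace I.Space,
      ∀ a ∈ I.ideal, IsStarNormal a →
        closure (unitaryOrbit ⊤ a) ⊆ I.normClosure (unitaryOrbit (finiteRankIdeal H) a),
      ∀ a ∈ I.ideal, a.IsPositive →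
        unitaryOrbit ⊤ a ⊆ I.normClosure (unitaryOrbit (finiteRankIdeal H) a)] ∧
    (TopologicalSpace.SeparableSpace I.Space → ∀ a ∈ I.ideal, IsStarNormal a →
      I.normClosure (unitaryOrbit (finiteRankIdeal H) a) =
          I.normClosure (unitaryOrbit I.ideal a) ∧
        I.normClosure (unitaryOrbit I.ideal a) = I.normClosure (unitaryOrbit ⊤ a) ∧
        I.normClosure (unitaryOrbit ⊤ a) = closure (unitaryOrbit ⊤ a)) := by
  obtain ⟨b⟩ := exists_hilbertBasis_nat hH
  have hpos : ∀ a : H →L[ℂ] H, a.IsPositive → IsStarNormal a := fun a ha =>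
    ha.isSelfAdjoint.isStarNormal
  -- The zero ideal contains no rank-one operators and is treated apart: its only orbit is `{0}`.
  by_cases hI0 : I.ideal = ⊥
  · have hzero : ∀ a ∈ I.ideal, a = 0 := fun a ha => by rwa [hI0, Submodule.mem_bot] at ha
    have hsub : Subsingleton I.Space := ⟨fun x y => SymmetricallyNormedIdeal.toOp_injective <|
      (hzero _ (SymmetricallyNormedIdeal.toOp_mem x)).trans
        (hzero _ (SymmetricallyNormedIdeal.toOp_mem y)).symm⟩
    have hsep : TopologicalSpace.SeparableSpace I.Space := inferInstance
    have h2 : ∀ a ∈ I.ideal,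
        closure (unitaryOrbit ⊤ a) ⊆ I.normClosure (unitaryOrbit (finiteRankIdeal H) a) := by
      intro a ha
      rw [hzero a ha, unitaryOrbit_zero, unitaryOrbit_zero, I.normClosure_singleton_zero,
        closure_singleton]
    refine ⟨?_, fun _ a ha _ => ?_⟩
    · tfae_have 1 → 2 := fun _ a ha _ => h2 a ha
      tfae_have 2 → 3 := fun h a ha hap => subset_closure.trans (h a ha (hpos a hap))
      tfae_have 3 → 1 := fun _ => hsep
      tfae_finish
    · rw [hzero a ha]
      simp only [unitaryOrbit_zero, I.normClosure_singleton_zero, closure_singleton, and_self]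
  · have h12 : TopologicalSpace.SeparableSpace I.Space → ∀ a ∈ I.ideal,
        closure (unitaryOrbit ⊤ a) ⊆ I.normClosure (unitaryOrbit (finiteRankIdeal H) a) :=
      fun _ a ha => (SymmetricallyNormedIdeal.closure_unitaryOrbit_top_subset b hI0 ha).trans
        (SymmetricallyNormedIdeal.normClosure_subset_normClosure
          (SymmetricallyNormedIdeal.unitaryOrbit_top_subset b ha))
    refine ⟨?_, fun hsep a ha _ => ?_⟩
    · tfae_have 1 → 2 := fun hsep a ha _ => h12 hsep a ha
      tfae_have 2 → 3 := fun h a ha hap => subset_closure.trans (h a ha (hpos a hap))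
      tfae_have 3 → 1 := fun h =>
        SymmetricallyNormedIdeal.separableSpace_of_subset_normClosure_finiteRank hI0 fun x hx =>
          SymmetricallyNormedIdeal.ideal_subset_normClosure_finiteRank hI0 hI b h hx
      tfae_finish
    · have h1 : I.normClosure (unitaryOrbit (finiteRankIdeal H) a) ⊆
          I.normClosure (unitaryOrbit I.ideal a) :=
        SymmetricallyNormedIdeal.normClosure_mono
          (unitaryOrbit_mono (SymmetricallyNormedIdeal.finiteRankIdeal_le hI0) a)
      have h2 : I.normClosure (unitaryOrbit I.ideal a) ⊆ I.normClosure (unitaryOrbit ⊤ a) :=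
        SymmetricallyNormedIdeal.normClosure_mono (unitaryOrbit_mono le_top a)
      have h3 := SymmetricallyNormedIdeal.normClosure_subset_closure (I := I) (unitaryOrbit ⊤ a)
      have h4 := h12 hsep a ha
      -- The four inclusions form a cycle, so all four closures agree.
      exact ⟨h1.antisymm ((h2.trans h3).trans h4), h2.antisymm ((h3.trans h4).trans h1),
        h3.antisymm ((h4.trans h1).trans h2)⟩
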